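/- Work with $F^\omega_{\le}$ (types and type operators only; no terms), with kinds $K ::= \star \mid K\to K$ and $\alpha$-equivalent types identified. Curry-style types are $A ::= X \mid \mathrm{T}_\star \mid A\to B \mid \forall X\le A:K.\,B \mid \Lambda X:K.\,A \mid A(B)$; Church-style types are the same except that variables $X_A$ carry an explicit bound $A$. Put $\mathrm{T}_{K\to K'}=\Lambda X:K.\,\mathrm{T}_{K'}$. Contexts are lists of declarations $X\le A:K$ with distinct variables, and $X:K$ abbreviates $X\le \mathrm{T}_K:K$. On Church-style types, the substitution $[C/X]$ replaces $X_A$ by $C$ and $Y_A$ by $Y_{A[C/X]}$ for $Y\neq X$. *Curry-style (traditional) system.* $\Gamma\vdash_T \mathrm{ok}$, $\Gamma\vdash_T A:K$ and $\Gamma\vdash_T A\le B$ are given by the following rules. Contexts: $()\vdash_T\mathrm{ok}$; if $\Gamma\vdash_T A:K$ and $X\notin\mathrm{dom}(\Gamma)$ then $\Gamma,X\le A:K\vdash_T\mathrm{ok}$. Kinding: if $\Gamma\vdash_T\mathrm{ok}$ then $\Gamma\vdash_T\mathrm{T}_\star:\star$, and $\Gamma\vdash_T X:K$ whenever $X\le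 A:K\in\Gamma$; if $\Gamma,X:K\vdash_T A:K'$ then $\Gamma\vdash_T\Lambda X:K.A:K\to K'$; if $\Gamma\vdash_T A:K\to K'$ and $\Gamma\vdash_T B:K$ then $\Gamma\vdash_T A(B):K'$; if $\Gamma\vdash_T A:\star$ and $\Gamma\vdash_T B:\star$ then $\Gamma\vdash_T A\to B:\star$; if $\Gamma,X\le A:K\vdash_T B:\star$ then $\Gamma\vdash_T\forall X\le A:K.B:\star$. Subtyping: (conversion) $A\le B$ if $\Gamma\vdash_T A:K$, $\Gamma\vdash_T B:K$ and $A=_\beta B$; transitivity; $A\le\mathrm{T}_K$ if $\Gamma\vdash_T A:K$; $X\le A$ if $\Gamma\vdash_T\mathrm{ok}$ and $X\le A:K\in\Gamma$; $\Lambda X:K.A\le\Lambda X:K.B$ if $\Gamma,X:K\vdash_T A\le B$; $A(C)\le B(C)$ if $A\le B$ and $\Gamma\vdash_T A(C):K$; $A_1\to A_2\le B_1\to B_2$ if $B_1\le A_1$, $A_2\le B_2$ and $\Gamma\vdash_T A_1\to A_2:\star$; and (kernel rule) $\forall X\le A:K.B\le\forall X\le A:K.D$ if $\Gamma,X\le A:K\vdash_T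 B\le D$ and $\Gamma\vdash_T\forall X\le A:K.B:\star$. *Church-style system.* $\Gamma\vdash A:K$ and $\Gamma\vdash A\le B:K$ are defined simultaneously; $\Gamma\vdash A=B:K$ means $\Gamma\vdash A\le B:K$ and $\Gamma\vdash B\le A:K$, and $\Gamma\vdash\mathrm{ok}$ means $\Gamma\vdash\mathrm{T}_\star:\star$. Kinding: $()\vdash\mathrm{T}_\star:\star$; $\Gamma,X\le A:K\vdash\mathrm{T}_\star:\star$ if $\Gamma\vdash A:K$ and $X\notin\mathrm{dom}(\Gamma)$; $\Gamma\vdash X_B:K$ if $\Gamma\vdash B:K$, $\Gamma\vdash A\le B:K$ and $X\le A:K\in\Gamma$; and the same rules as above for $\Lambda$, application, $\to$ and $\forall$. Subtyping: reflexivity on well-kinded types; transitivity; $A\le\mathrm{T}_K:K$ if $\Gamma\vdash A:K$; if $X\le A:K\in\Gamma$ and $\Gamma\vdash A\le B:K$, then $X_B\le X_C:K$ provided $\Gamma\vdash B=C:K$, and $X_B\le B:K$ provided $\Gamma\vdash B:K$; $\Lambda X:K.A\le\Lambda X:K.B:K\to K'$ if $\Gamma,X:K\vdash A\le B:K'$;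 $A(B)\le C(D):K'$ if $\Gamma\vdash A\le C:K\to K'$ and $\Gamma\vdash B=D:K$; $A_1\to A_2\le B_1\to B_2:\star$ if $\Gamma\vdash B_1\le A_1:\star$ and $\Gamma\vdash A_2\le B_2:\star$; $\forall X\le A:K.B\le\forall X\le C:K.D:\star$ if $\Gamma\vdash A=C:K$ and $\Gamma,X\le A:K\vdash B\le D:\star$; and both $(\Lambda X:K.A)(B)\le A[B/X]:K'$ and $A[B/X]\le(\Lambda X:K.A)(B):K'$ if $\Gamma,X:K\vdash A:K'$ and $\Gamma\vdash B:K$. *Decoration.* For a Church-style context $\Gamma$, the partial map $A\mapsto A^\Gamma$ from Curry-style to Church-style types is given by $X^\Gamma=X_B$ if $X\le B:K\in\Gamma$ (undefined if $X$ is not declared in $\Gamma$), $\mathrm{T}_\star^\Gamma=\mathrm{T}_\star$, $(A\to B)^\Gamma=A^\Gamma\to B^\Gamma$, $(A(B))^\Gamma=A^\Gamma(B^\Gamma)$, $(\Lambda X:K.A)^\Gamma=\Lambda X:K.A^{\Gamma,X:K}$ and $(\forall X\le A:K.B)^\Gamma=\forall X\le A^\Gamma:K.\,B^{\Gamma,X\le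 A^\Gamma:K}$. On Curry-style contexts, $()^d=()$ and $(\Gamma,X\le A:K)^d=\Gamma^d,X\le A^{\Gamma^d}:K$, again partial. **Lemma (Soundness).** Let $\Gamma$ be a Curry-style context, $A,B$ Curry-style types and $K$ a kind. 1. If $\Gamma\vdash_T A:K$, then $\Gamma^d$ and $A^{\Gamma^d}$ are defined and $\Gamma^d\vdash A^{\Gamma^d}:K$. 2. If $\Gamma\vdash_T A\le B$, $\Gamma\vdash_T A:K$ and $\Gamma\vdash_T B:K$, then $\Gamma^d$, $A^{\Gamma^d}$ and $B^{\Gamma^d}$ are defined and well-formed (that is, $\Gamma^d\vdash\mathrm{ok}$, $\Gamma^d\vdash A^{\Gamma^d}:K$ and $\Gamma^d\vdash B^{\Gamma^d}:K$), and $\Gamma^d\vdash A^{\Gamma^d}\le B^{\Gamma^d}:K$. -/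

import Mathlib

/-!
# Higher-order bounded quantification, in Curry style and in Church style

Types are taken up to renaming of bound variables by means of de Bruijn indices: the index `n`
refers to the `n`-th enclosing binder, and, beyond the binders of the type, to the entries of the
context, the most recently declared entry being number `0`. Raw types may contain indices that are
not declared anywhere. The freshness condition on a newly declared variable is automatic.
-/

namespace FOmegaSub

/-- Kinds: the kind `⋆` of proper types and the kinds `K → K'` of type operators. -/
inductive Kind : Type where
  | star : Kind
  | arr : Kind → Kind → Kind

/-- Lifting of a renaming of indices below a binder. -/
def liftRen (ρ : ℕ → ℕ) : ℕ → ℕ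
  | 0 => 0
  | n + 1 => ρ n + 1

/-! ## The traditional system (Curry style) -/

namespace Curry

/-- Types of the traditional system; variables carry no bound. -/
inductive Ty : Type where
  /-- a type variable `X` -/
  | var : ℕ → Ty
  /-- the top type of kind `⋆` -/
  | top : Ty
  /-- the function type `A → B` -/
  | arrow : Ty → Ty → Ty
  /-- the quantified type `∀ X ≤ A : K. B`; binds a variable in `B` -/
  | all : Ty → Kind → Ty → Ty
  /-- the type operator `Λ X : K. A`; binds a variable in `A` -/
  | abs : Kind → Ty → Ty
  /-- the application `A(B)` -/
  | app : Ty → Ty → Ty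

namespace Ty

/-- Renaming of variables. -/
def rename : (ℕ → ℕ) → Ty → Ty
  | ρ, var X => var (ρ X)
  | _, top => top
  | ρ, arrow A B => arrow (rename ρ A) (rename ρ B)
  | ρ, all A K B => all (rename ρ A) K (rename (liftRen ρ) B)
  | ρ, abs K A => abs K (rename (liftRen ρ) A)
  | ρ, app A B => app (rename ρ A) (rename ρ B)

/-- Weakening by one new variable. -/
def shift (A : Ty) : Ty := rename Nat.succ A

/-- Lifting of a parallel substitution below a binder. -/
def liftSubst (σ : ℕ → Ty) : ℕ → Ty
  | 0 => var 0
  | n + 1 => (σ n).shift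

/-- Capture-avoiding parallel substitution. -/
def subst : (ℕ → Ty) → Ty → Ty
  | σ, var X => σ X
  | _, top => top
  | σ, arrow A B => arrow (subst σ A) (subst σ B)
  | σ, all A K B => all (subst σ A) K (subst (liftSubst σ) B)
  | σ, abs K A => abs K (subst (liftSubst σ) A)
  | σ, app A B => app (subst σ A) (subst σ B)

/-- The parallel substitution that replaces the variable `0` by `B` and fixes the others. -/
def single (B : Ty) : ℕ → Ty
  | 0 => B
  | n + 1 => var n

/-- `A.inst B` is `A[B/X]`, where `X` is the variable `0` of `A`. -/
def inst (A B : Ty) : Ty := subst (single B) A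

/-- The top type `T_K` at the kind `K`: `T_{K → K'} = Λ X : K. T_{K'}`. -/
def topAt : Kind → Ty
  | Kind.star => top
  | Kind.arr K K' => abs K (topAt K')

/-- One-step `β`-reduction, in any position. -/
inductive Step : Ty → Ty → Prop where
  | beta (K : Kind) (A B : Ty) : Step (app (abs K A) B) (inst A B)
  | arrowL {A A' : Ty} (B : Ty) : Step A A' → Step (arrow A B) (arrow A' B)
  | arrowR (A : Ty) {B B' : Ty} : Step B B' → Step (arrow A B) (arrow A B')
  | allL {A A' : Ty} (K : Kind) (B : Ty) : Step A A' → Step (all A K B) (all A' K B)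
  | allR (A : Ty) (K : Kind) {B B' : Ty} : Step B B' → Step (all A K B) (all A K B')
  | abs (K : Kind) {A A' : Ty} : Step A A' → Step (abs K A) (abs K A')
  | appL {A A' : Ty} (B : Ty) : Step A A' → Step (app A B) (app A' B)
  | appR (A : Ty) {B B' : Ty} : Step B B' → Step (app A B) (app A B')

/-- `β`-equality: the equivalence relation generated by one-step `β`-reduction. -/
def BetaEq : Ty → Ty → Prop := Relation.EqvGen Step

end Ty

/-- Contexts: lists of declarations `X ≤ A : K`, the most recent one first. The bound `A` lives in
the tail of the list that follows its declaration. -/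
abbrev Ctx : Type := List (Ty × Kind)

/-- `lookup Γ X = some (A, K)` says that `X ≤ A : K` is a declaration of `Γ`, where `A` has been
weakened to the whole of `Γ`. -/
def lookup : Ctx → ℕ → Option (Ty × Kind)
  | [], _ => none
  | (A, K) :: _, 0 => some (A.shift, K)
  | _ :: Γ, n + 1 => (lookup Γ n).map fun p => (p.1.shift, p.2)

mutual

/-- `Γ ⊢_T ok`: the context `Γ` is well-formed. -/
inductive Ok : Ctx → Prop where
  | nil : Ok []
  | cons {Γ : Ctx} {A : Ty} {K : Kind} : HasKind Γ A K → Ok ((A, K) :: Γ)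

/-- `Γ ⊢_T A : K`: the type `A` has kind `K` in the context `Γ`. -/
inductive HasKind : Ctx → Ty → Kind → Prop where
  | var {Γ : Ctx} {X : ℕ} {A : Ty} {K : Kind} :
      Ok Γ → lookup Γ X = some (A, K) → HasKind Γ (Ty.var X) K
  | top {Γ : Ctx} : Ok Γ → HasKind Γ Ty.top Kind.star
  | abs {Γ : Ctx} {A : Ty} {K K' : Kind} :
      HasKind ((Ty.topAt K, K) :: Γ) A K' → HasKind Γ (Ty.abs K A) (Kind.arr K K')
  | app {Γ : Ctx} {A B : Ty} {K K' : Kind} :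
      HasKind Γ A (Kind.arr K K') → HasKind Γ B K → HasKind Γ (Ty.app A B) K'
  | arrow {Γ : Ctx} {A B : Ty} :
      HasKind Γ A Kind.star → HasKind Γ B Kind.star → HasKind Γ (Ty.arrow A B) Kind.star
  | all {Γ : Ctx} {A B : Ty} {K : Kind} :
      HasKind ((A, K) :: Γ) B Kind.star → HasKind Γ (Ty.all A K B) Kind.star

end

/-- `Γ ⊢_T A ≤ B`: subtyping of the traditional system, with the kernel rule for quantified
types (the bounds on both sides coincide). -/
inductive Sub : Ctx → Ty → Ty → Prop where
  | conv {Γ : Ctx} {A B : Ty} {K : Kind} :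
      HasKind Γ A K → HasKind Γ B K → Ty.BetaEq A B → Sub Γ A B
  | trans {Γ : Ctx} {A B C : Ty} : Sub Γ A B → Sub Γ B C → Sub Γ A C
  | top {Γ : Ctx} {A : Ty} {K : Kind} : HasKind Γ A K → Sub Γ A (Ty.topAt K)
  | var {Γ : Ctx} {X : ℕ} {A : Ty} {K : Kind} :
      Ok Γ → lookup Γ X = some (A, K) → Sub Γ (Ty.var X) A
  | abs {Γ : Ctx} {A B : Ty} {K : Kind} :
      Sub ((Ty.topAt K, K) :: Γ) A B → Sub Γ (Ty.abs K A) (Ty.abs K B)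
  | app {Γ : Ctx} {A B C : Ty} {K : Kind} :
      Sub Γ A B → HasKind Γ (Ty.app A C) K → Sub Γ (Ty.app A C) (Ty.app B C)
  | arrow {Γ : Ctx} {A₁ A₂ B₁ B₂ : Ty} :
      Sub Γ B₁ A₁ → Sub Γ A₂ B₂ → HasKind Γ (Ty.arrow A₁ A₂) Kind.star →
        Sub Γ (Ty.arrow A₁ A₂) (Ty.arrow B₁ B₂)
  | all {Γ : Ctx} {A B D : Ty} {K : Kind} :
      Sub ((A, K) :: Γ) B D → HasKind Γ (Ty.all A K B) Kind.star →
        Sub Γ (Ty.all A K B) (Ty.all A K D)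

end Curry

/-! ## The system with bounds on variables (Church style) -/

namespace Church

/-- Types in which every variable carries a bound. -/
inductive Ty : Type where
  /-- the variable `X_A` with the explicit bound `A` -/
  | var : ℕ → Ty → Ty
  /-- the top type of kind `⋆` -/
  | top : Ty
  /-- the function type `A → B` -/
  | arrow : Ty → Ty → Ty
  /-- the quantified type `∀ X ≤ A : K. B`; binds a variable in `B` -/
  | all : Ty → Kind → Ty → Ty
  /-- the type operator `Λ X : K. A`; binds a variable in `A` -/
  | abs : Kind → Ty → Ty
  /-- the application `A(B)` -/
  | app : Ty → Ty → Ty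

/-- The value of a parallel substitution at a variable: a renaming `[X ← Y]` or a
replacement `[B/X]`. -/
inductive Entry : Type where
  | ren : ℕ → Entry
  | sub : Ty → Entry

namespace Ty

/-- Renaming of variables, also inside the bounds carried by variables. -/
def rename : (ℕ → ℕ) → Ty → Ty
  | ρ, var X A => var (ρ X) (rename ρ A)
  | _, top => top
  | ρ, arrow A B => arrow (rename ρ A) (rename ρ B)
  | ρ, all A K B => all (rename ρ A) K (rename (liftRen ρ) B)
  | ρ, abs K A => abs K (rename (liftRen ρ) A)
  | ρ, app A B => app (rename ρ A) (rename ρ B)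

/-- Weakening by one new variable. -/
def shift (A : Ty) : Ty := rename Nat.succ A

end Ty

/-- Weakening of an entry by one new variable. -/
def Entry.shift : Entry → Entry
  | Entry.ren Y => Entry.ren (Y + 1)
  | Entry.sub B => Entry.sub B.shift

namespace Ty

/-- Lifting of a parallel substitution below a binder: the new variable is renamed to itself. -/
def liftSubst (γ : ℕ → Entry) : ℕ → Entry
  | 0 => Entry.ren 0
  | n + 1 => (γ n).shift

/-- Capture-avoiding parallel substitution. A renaming `[X ← Y]` turns `X_A` into `Y_{A[γ]}`, a
replacement `[B/X]` turns it into `B`. -/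
def subst : (ℕ → Entry) → Ty → Ty
  | γ, var X A =>
    match γ X with
    | Entry.ren Y => var Y (subst γ A)
    | Entry.sub B => B
  | _, top => top
  | γ, arrow A B => arrow (subst γ A) (subst γ B)
  | γ, all A K B => all (subst γ A) K (subst (liftSubst γ) B)
  | γ, abs K A => abs K (subst (liftSubst γ) A)
  | γ, app A B => app (subst γ A) (subst γ B)

/-- The parallel substitution that replaces the variable `0` by `B` and is the identity renaming
on the other variables. -/
def single (B : Ty) : ℕ → Entry
  | 0 => Entry.sub B
  | n + 1 => Entry.ren n

/-- `A.inst B` is `A[B/X]`, where `X` is the variable `0` of `A`. -/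
def inst (A B : Ty) : Ty := subst (single B) A

/-- The top type `T_K` at the kind `K`: `T_{K → K'} = Λ X : K. T_{K'}`. -/
def topAt : Kind → Ty
  | Kind.star => top
  | Kind.arr K K' => abs K (topAt K')

end Ty

/-- Contexts: lists of declarations `X ≤ A : K`, the most recent one first. The bound `A` lives in
the tail of the list that follows its declaration. -/
abbrev Ctx : Type := List (Ty × Kind)

/-- `lookup Γ X = some (A, K)` says that `X ≤ A : K` is a declaration of `Γ`, where `A` has been
weakened to the whole of `Γ`. -/
def lookup : Ctx → ℕ → Option (Ty × Kind)
  | [], _ => none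
  | (A, K) :: _, 0 => some (A.shift, K)
  | _ :: Γ, n + 1 => (lookup Γ n).map fun p => (p.1.shift, p.2)

mutual

/-- `Γ ⊢ A : K`: the type `A` has kind `K` in the context `Γ`. -/
inductive HasKind : Ctx → Ty → Kind → Prop where
  | topEmp : HasKind [] Ty.top Kind.star
  | topExt {Γ : Ctx} {A : Ty} {K : Kind} :
      HasKind Γ A K → HasKind ((A, K) :: Γ) Ty.top Kind.star
  | var {Γ : Ctx} {X : ℕ} {A B : Ty} {K : Kind} :
      HasKind Γ B K → Sub Γ A B K → lookup Γ X = some (A, K) → HasKind Γ (Ty.var X B) K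
  | abs {Γ : Ctx} {A : Ty} {K K' : Kind} :
      HasKind ((Ty.topAt K, K) :: Γ) A K' → HasKind Γ (Ty.abs K A) (Kind.arr K K')
  | app {Γ : Ctx} {A B : Ty} {K K' : Kind} :
      HasKind Γ A (Kind.arr K K') → HasKind Γ B K → HasKind Γ (Ty.app A B) K'
  | arrow {Γ : Ctx} {A B : Ty} :
      HasKind Γ A Kind.star → HasKind Γ B Kind.star → HasKind Γ (Ty.arrow A B) Kind.star
  | all {Γ : Ctx} {A B : Ty} {K : Kind} :
      HasKind ((A, K) :: Γ) B Kind.star → HasKind Γ (Ty.all A K B) Kind.star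

/-- `Γ ⊢ A ≤ B : K`: the type `A` is a subtype of `B` at the kind `K` in the context `Γ`. An
equality `Γ ⊢ A = B : K` in a premise is written as the two inequalities it stands for. -/
inductive Sub : Ctx → Ty → Ty → Kind → Prop where
  | refl {Γ : Ctx} {A : Ty} {K : Kind} : HasKind Γ A K → Sub Γ A A K
  | trans {Γ : Ctx} {A B C : Ty} {K : Kind} : Sub Γ A B K → Sub Γ B C K → Sub Γ A C K
  | top {Γ : Ctx} {A : Ty} {K : Kind} : HasKind Γ A K → Sub Γ A (Ty.topAt K) K
  | var {Γ : Ctx} {X : ℕ} {A B C : Ty} {K : Kind} :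
      Sub Γ A B K → Sub Γ B C K → Sub Γ C B K → lookup Γ X = some (A, K) →
        Sub Γ (Ty.var X B) (Ty.var X C) K
  | promote {Γ : Ctx} {X : ℕ} {A B : Ty} {K : Kind} :
      Sub Γ A B K → HasKind Γ B K → lookup Γ X = some (A, K) → Sub Γ (Ty.var X B) B K
  | abs {Γ : Ctx} {A B : Ty} {K K' : Kind} :
      Sub ((Ty.topAt K, K) :: Γ) A B K' → Sub Γ (Ty.abs K A) (Ty.abs K B) (Kind.arr K K')
  | app {Γ : Ctx} {A B C D : Ty} {K K' : Kind} :
      Sub Γ A C (Kind.arr K K') → Sub Γ B D K → Sub Γ D B K →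
        Sub Γ (Ty.app A B) (Ty.app C D) K'
  | arrow {Γ : Ctx} {A₁ A₂ B₁ B₂ : Ty} :
      Sub Γ B₁ A₁ Kind.star → Sub Γ A₂ B₂ Kind.star →
        Sub Γ (Ty.arrow A₁ A₂) (Ty.arrow B₁ B₂) Kind.star
  | all {Γ : Ctx} {A B C D : Ty} {K : Kind} :
      Sub Γ A C K → Sub Γ C A K → Sub ((A, K) :: Γ) B D Kind.star →
        Sub Γ (Ty.all A K B) (Ty.all C K D) Kind.star
  | betaL {Γ : Ctx} {A B : Ty} {K K' : Kind} :
      HasKind ((Ty.topAt K, K) :: Γ) A K' → HasKind Γ B K →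
        Sub Γ (Ty.app (Ty.abs K A) B) (Ty.inst A B) K'
  | betaR {Γ : Ctx} {A B : Ty} {K K' : Kind} :
      HasKind ((Ty.topAt K, K) :: Γ) A K' → HasKind Γ B K →
        Sub Γ (Ty.inst A B) (Ty.app (Ty.abs K A) B) K'

end

/-- `Γ ⊢ ok`, the well-formedness of a context, stands for `Γ ⊢ T_⋆ : ⋆`. -/
def Ok (Γ : Ctx) : Prop := HasKind Γ Ty.top Kind.star

end Church

/-! ## Decoration -/

/-- The decoration `A^Γ` of a traditional type `A` in a context `Γ` with bounded variables; it is
undefined (`none`) if `A` has a free variable that `Γ` does not declare. -/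
def decorate : Church.Ctx → Curry.Ty → Option Church.Ty
  | Γ, Curry.Ty.var X => (Church.lookup Γ X).map fun p => Church.Ty.var X p.1
  | _, Curry.Ty.top => some Church.Ty.top
  | Γ, Curry.Ty.arrow A B =>
    (decorate Γ A).bind fun A' => (decorate Γ B).bind fun B' => some (Church.Ty.arrow A' B')
  | Γ, Curry.Ty.all A K B =>
    (decorate Γ A).bind fun A' =>
      (decorate ((A', K) :: Γ) B).bind fun B' => some (Church.Ty.all A' K B')
  | Γ, Curry.Ty.abs K A =>
    (decorate ((Church.Ty.topAt K, K) :: Γ) A).bind fun A' => some (Church.Ty.abs K A')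
  | Γ, Curry.Ty.app A B =>
    (decorate Γ A).bind fun A' => (decorate Γ B).bind fun B' => some (Church.Ty.app A' B')

/-- The decoration `Γ^d` of a traditional context, a partial function as well. -/
def decorateCtx : Curry.Ctx → Option Church.Ctx
  | [] => some []
  | (A, K) :: Γ =>
    (decorateCtx Γ).bind fun Γ' => (decorate Γ' A).bind fun A' => some ((A', K) :: Γ')

end FOmegaSub

open FOmegaSub

namespace FOmegaSub

theorem liftRen_comp (ρ τ : ℕ → ℕ) : liftRen ρ ∘ liftRen τ = liftRen (ρ ∘ τ) := by
  funext n; cases n <;> rfl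

/-! ## Renaming, substitution and parallel reduction of Curry-style types -/

namespace Curry

namespace Ty

theorem rename_rename (A : Ty) : ∀ ρ τ : ℕ → ℕ, rename ρ (rename τ A) = rename (ρ ∘ τ) A := by
  induction A <;> intro ρ τ <;> simp_all [rename, liftRen_comp]

theorem liftSubst_comp_liftRen (σ : ℕ → Ty) (ρ : ℕ → ℕ) :
    liftSubst σ ∘ liftRen ρ = liftSubst (σ ∘ ρ) := by
  funext n; cases n <;> rfl

theorem subst_rename (A : Ty) :
    ∀ (σ : ℕ → Ty) (ρ : ℕ → ℕ), subst σ (rename ρ A) = subst (σ ∘ ρ) A := by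
  induction A <;> intro σ ρ <;> simp_all [rename, subst, liftSubst_comp_liftRen]

theorem rename_shift (ρ : ℕ → ℕ) (A : Ty) : rename (liftRen ρ) A.shift = (rename ρ A).shift := by
  simp only [shift, rename_rename]; rfl

theorem rename_comp_liftSubst (ρ : ℕ → ℕ) (σ : ℕ → Ty) :
    rename (liftRen ρ) ∘ liftSubst σ = liftSubst (rename ρ ∘ σ) := by
  funext n
  cases n with
  | zero => rfl
  | succ n => exact rename_shift ρ (σ n)

theorem rename_subst (A : Ty) :
    ∀ (ρ : ℕ → ℕ) (σ : ℕ → Ty), rename ρ (subst σ A) = subst (rename ρ ∘ σ) A := by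
  induction A <;> intro ρ σ <;> simp_all [rename, subst, rename_comp_liftSubst]

theorem subst_shift (σ : ℕ → Ty) (A : Ty) : subst (liftSubst σ) A.shift = (subst σ A).shift := by
  simp only [shift, subst_rename, rename_subst]; rfl

theorem subst_comp_liftSubst (σ τ : ℕ → Ty) :
    subst (liftSubst σ) ∘ liftSubst τ = liftSubst (subst σ ∘ τ) := by
  funext n
  cases n with
  | zero => rfl
  | succ n => exact subst_shift σ (τ n)

theorem subst_subst (A : Ty) :
    ∀ σ τ : ℕ → Ty, subst σ (subst τ A) = subst (subst σ ∘ τ) A := by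
  induction A <;> intro σ τ <;> simp_all [subst, subst_comp_liftSubst]

theorem liftSubst_var : liftSubst var = var := by
  funext n; cases n <;> rfl

theorem subst_var (A : Ty) : subst var A = A := by
  induction A <;> simp_all [subst, liftSubst_var]

theorem inst_shift (A B : Ty) : inst A.shift B = A := by
  simp only [inst, shift, subst_rename]
  exact subst_var A

theorem rename_inst (ρ : ℕ → ℕ) (A B : Ty) :
    rename ρ (inst A B) = inst (rename (liftRen ρ) A) (rename ρ B) := by
  simp only [inst, rename_subst, subst_rename]
  congr 1
  funext n; cases n <;> rfl

theorem subst_inst (σ : ℕ → Ty) (A B : Ty) :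
    subst σ (inst A B) = inst (subst (liftSubst σ) A) (subst σ B) := by
  simp only [inst, subst_subst]
  congr 1
  funext n
  cases n with
  | zero => rfl
  | succ n => exact (inst_shift (σ n) _).symm

/-- Parallel `β`-reduction. -/
inductive Par : Ty → Ty → Prop where
  | var (X : ℕ) : Par (var X) (var X)
  | top : Par top top
  | arrow {A A' B B' : Ty} : Par A A' → Par B B' → Par (arrow A B) (arrow A' B')
  | all {A A' B B' : Ty} (K : Kind) : Par A A' → Par B B' → Par (all A K B) (all A' K B')
  | abs {A A' : Ty} (K : Kind) : Par A A' → Par (abs K A) (abs K A')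
  | app {A A' B B' : Ty} : Par A A' → Par B B' → Par (app A B) (app A' B')
  | beta {A A' B B' : Ty} (K : Kind) :
      Par A A' → Par B B' → Par (app (Ty.abs K A) B) (inst A' B')

theorem Par.refl (A : Ty) : Par A A := by
  induction A <;> constructor <;> assumption

theorem Step.par {A B : Ty} (h : Step A B) : Par A B := by
  induction h with
  | beta K A B => exact .beta K (.refl A) (.refl B)
  | arrowL B _ ih => exact .arrow ih (.refl B)
  | arrowR A _ ih => exact .arrow (.refl A) ih
  | allL K B _ ih => exact .all K ih (.refl B)
  | allR A K _ ih => exact .all K (.refl A) ih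
  | abs K _ ih => exact .abs K ih
  | appL B _ ih => exact .app ih (.refl B)
  | appR A _ ih => exact .app (.refl A) ih

theorem Par.rename {A B : Ty} (h : Par A B) : ∀ ρ : ℕ → ℕ, Par (A.rename ρ) (B.rename ρ) := by
  induction h with
  | var X => exact fun ρ => .var _
  | top => exact fun ρ => .top
  | arrow _ _ ih₁ ih₂ => exact fun ρ => .arrow (ih₁ ρ) (ih₂ ρ)
  | all K _ _ ih₁ ih₂ => exact fun ρ => .all K (ih₁ ρ) (ih₂ _)
  | abs K _ ih => exact fun ρ => .abs K (ih _)
  | app _ _ ih₁ ih₂ => exact fun ρ => .app (ih₁ ρ) (ih₂ ρ)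
  | beta K _ _ ih₁ ih₂ =>
    intro ρ
    rw [rename_inst]
    exact .beta K (ih₁ _) (ih₂ ρ)

theorem Par.liftSubst {σ τ : ℕ → Ty} (h : ∀ n, Par (σ n) (τ n)) :
    ∀ n, Par (liftSubst σ n) (liftSubst τ n)
  | 0 => .var 0
  | n + 1 => (h n).rename _

theorem Par.subst {A B : Ty} (h : Par A B) :
    ∀ {σ τ : ℕ → Ty}, (∀ n, Par (σ n) (τ n)) → Par (A.subst σ) (B.subst τ) := by
  induction h with
  | var X => exact fun hs => hs X
  | top => exact fun _ => .top
  | arrow _ _ ih₁ ih₂ => exact fun hs => .arrow (ih₁ hs) (ih₂ hs)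
  | all K _ _ ih₁ ih₂ => exact fun hs => .all K (ih₁ hs) (ih₂ (Par.liftSubst hs))
  | abs K _ ih => exact fun hs => .abs K (ih (Par.liftSubst hs))
  | app _ _ ih₁ ih₂ => exact fun hs => .app (ih₁ hs) (ih₂ hs)
  | beta K _ _ ih₁ ih₂ =>
    intro σ τ hs
    rw [subst_inst]
    exact .beta K (ih₁ (Par.liftSubst hs)) (ih₂ hs)

theorem Par.inst {A A' B B' : Ty} (hA : Par A A') (hB : Par B B') :
    Par (A.inst B) (A'.inst B') := by
  refine hA.subst fun n => ?_
  cases n with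
  | zero => exact hB
  | succ n => exact .var n

/-- The complete development: contraction of all redexes of a type. -/
def dev : Ty → Ty
  | var X => var X
  | top => top
  | arrow A B => arrow (dev A) (dev B)
  | all A K B => all (dev A) K (dev B)
  | abs K A => abs K (dev A)
  | app (abs _ A) B => inst (dev A) (dev B)
  | app A B => app (dev A) (dev B)

theorem Par.par_dev {A B : Ty} (h : Par A B) : Par B (dev A) := by
  induction h with
  | var X => exact .var X
  | top => exact .top
  | arrow _ _ ih₁ ih₂ => exact .arrow ih₁ ih₂
  | all K _ _ ih₁ ih₂ => exact .all K ih₁ ih₂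
  | abs K _ ih => exact .abs K ih
  | @app A A' B B' h₁ h₂ ih₁ ih₂ =>
    cases h₁ with
    | abs K h =>
      cases ih₁ with
      | abs _ ih => exact .beta K ih ih₂
    | _ => exact .app ih₁ ih₂
  | beta K _ _ ih₁ ih₂ => exact ih₁.inst ih₂

theorem BetaEq.join_par {A B : Ty} (h : BetaEq A B) :
    Relation.Join (Relation.ReflTransGen Par) A B := by
  have he : Equivalence (Relation.Join (Relation.ReflTransGen Par)) :=
    Relation.equivalence_join_reflTransGen fun a _ _ hb hc =>
      ⟨dev a, .single hb.par_dev, .single hc.par_dev⟩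
  induction h with
  | rel A B h => exact ⟨B, .single h.par, .refl⟩
  | refl A => exact he.refl A
  | symm A B _ ih => exact he.symm ih
  | trans A B C _ _ ih₁ ih₂ => exact he.trans ih₁ ih₂

end Ty

/-! ## Kinding of Curry-style types by the kinds of their variables -/

open Ty

/-- `WellKinded Θ A K`: the type `A` has kind `K` when its variables have the kinds listed
in `Θ`. -/
inductive WellKinded : List Kind → Ty → Kind → Prop where
  | var {Θ : List Kind} {X : ℕ} {K : Kind} : Θ[X]? = some K → WellKinded Θ (var X) K
  | top {Θ : List Kind} : WellKinded Θ top Kind.star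
  | abs {Θ : List Kind} {A : Ty} {K K' : Kind} :
      WellKinded (K :: Θ) A K' → WellKinded Θ (abs K A) (Kind.arr K K')
  | app {Θ : List Kind} {A B : Ty} {K K' : Kind} :
      WellKinded Θ A (Kind.arr K K') → WellKinded Θ B K → WellKinded Θ (app A B) K'
  | arrow {Θ : List Kind} {A B : Ty} :
      WellKinded Θ A Kind.star → WellKinded Θ B Kind.star → WellKinded Θ (arrow A B) Kind.star
  | all {Θ : List Kind} {A B : Ty} {K : Kind} :
      WellKinded Θ A K → WellKinded (K :: Θ) B Kind.star → WellKinded Θ (all A K B) Kind.star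

namespace WellKinded

theorem unique {Θ : List Kind} {A : Ty} {K : Kind} (h : WellKinded Θ A K) :
    ∀ {K' : Kind}, WellKinded Θ A K' → K = K' := by
  induction h with
  | var h => rintro _ ⟨⟩; simp_all
  | top => rintro _ ⟨⟩; rfl
  | abs _ ih => rintro _ ⟨⟩; rw [ih ‹_›]
  | app _ _ ih _ => rintro _ ⟨⟩; cases ih ‹_›; rfl
  | arrow => rintro _ ⟨⟩; rfl
  | all => rintro _ ⟨⟩; rfl

theorem topAt (Θ : List Kind) (K : Kind) : WellKinded Θ (Ty.topAt K) K := by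
  induction K generalizing Θ with
  | star => exact .top
  | arr K K' _ ih => exact .abs (ih _)

theorem rename {Θ : List Kind} {A : Ty} {K : Kind} (h : WellKinded Θ A K) :
    ∀ {Θ' : List Kind} {ρ : ℕ → ℕ}, (∀ X K, Θ[X]? = some K → Θ'[ρ X]? = some K) →
      WellKinded Θ' (A.rename ρ) K := by
  have lift {Θ Θ' : List Kind} {ρ : ℕ → ℕ} (hρ : ∀ X K, Θ[X]? = some K → Θ'[ρ X]? = some K)
      (K' : Kind) : ∀ X K, (K' :: Θ)[X]? = some K → (K' :: Θ')[liftRen ρ X]? = some K := by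
    intro X K hX
    cases X with
    | zero => exact hX
    | succ X => exact hρ X K hX
  induction h with
  | var h => exact fun hρ => .var (hρ _ _ h)
  | top => exact fun _ => .top
  | abs _ ih => exact fun hρ => .abs (ih (lift hρ _))
  | app _ _ ih₁ ih₂ => exact fun hρ => .app (ih₁ hρ) (ih₂ hρ)
  | arrow _ _ ih₁ ih₂ => exact fun hρ => .arrow (ih₁ hρ) (ih₂ hρ)
  | all _ _ ih₁ ih₂ => exact fun hρ => .all (ih₁ hρ) (ih₂ (lift hρ _))

theorem shift {Θ : List Kind} {A : Ty} {K : Kind} (h : WellKinded Θ A K) (K' : Kind) :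
    WellKinded (K' :: Θ) A.shift K :=
  h.rename fun _ _ hX => hX

theorem subst {Θ : List Kind} {A : Ty} {K : Kind} (h : WellKinded Θ A K) :
    ∀ {Θ' : List Kind} {σ : ℕ → Ty}, (∀ X K, Θ[X]? = some K → WellKinded Θ' (σ X) K) →
      WellKinded Θ' (A.subst σ) K := by
  have lift {Θ Θ' : List Kind} {σ : ℕ → Ty} (hσ : ∀ X K, Θ[X]? = some K → WellKinded Θ' (σ X) K)
      (K' : Kind) : ∀ X K, (K' :: Θ)[X]? = some K → WellKinded (K' :: Θ') (liftSubst σ X) K := by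
    intro X K hX
    cases X with
    | zero => exact .var hX
    | succ X => exact (hσ X K hX).shift K'
  induction h with
  | var h => exact fun hσ => hσ _ _ h
  | top => exact fun _ => .top
  | abs _ ih => exact fun hσ => .abs (ih (lift hσ _))
  | app _ _ ih₁ ih₂ => exact fun hσ => .app (ih₁ hσ) (ih₂ hσ)
  | arrow _ _ ih₁ ih₂ => exact fun hσ => .arrow (ih₁ hσ) (ih₂ hσ)
  | all _ _ ih₁ ih₂ => exact fun hσ => .all (ih₁ hσ) (ih₂ (lift hσ _))

theorem inst {Θ : List Kind} {A B : Ty} {K K' : Kind} (hA : WellKinded (K :: Θ) A K')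
    (hB : WellKinded Θ B K) : WellKinded Θ (A.inst B) K' := by
  refine hA.subst fun X L hX => ?_
  cases X with
  | zero => cases hX; exact hB
  | succ X => exact .var hX

/-- Subject reduction. -/
theorem par {A B : Ty} (h : Par A B) :
    ∀ {Θ : List Kind} {K : Kind}, WellKinded Θ A K → WellKinded Θ B K := by
  induction h with
  | var X => exact fun h => h
  | top => exact fun h => h
  | arrow _ _ ih₁ ih₂ => rintro _ _ ⟨⟩; exact .arrow (ih₁ ‹_›) (ih₂ ‹_›)
  | all K _ _ ih₁ ih₂ => rintro _ _ ⟨⟩; exact .all (ih₁ ‹_›) (ih₂ ‹_›)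
  | abs K _ ih => rintro _ _ ⟨⟩; exact .abs (ih ‹_›)
  | app _ _ ih₁ ih₂ =>
    intro _ _ h
    cases h with
    | app h₁ h₂ => exact .app (ih₁ h₁) (ih₂ h₂)
  | beta K _ _ ih₁ ih₂ =>
    intro _ _ h
    cases h with
    | app h₁ h₂ =>
      cases h₁ with
      | abs h₁ => exact (ih₁ h₁).inst (ih₂ h₂)

end WellKinded

/-- A context is well-kinded if each bound is, over the declarations that precede it. -/
def CtxWellKinded : Ctx → Prop
  | [] => True
  | (A, K) :: Γ => CtxWellKinded Γ ∧ WellKinded (Γ.map Prod.snd) A K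

theorem lookup_kind {Γ : Ctx} : ∀ {X : ℕ} {A : Ty} {K : Kind},
    lookup Γ X = some (A, K) → (Γ.map Prod.snd)[X]? = some K := by
  induction Γ with
  | nil => intro X A K h; cases h
  | cons p Γ ih =>
    intro X A K h
    cases X with
    | zero => cases h; rfl
    | succ X =>
      simp only [lookup, Option.map_eq_some_iff, Prod.mk.injEq] at h
      obtain ⟨⟨A', K'⟩, h, -, rfl⟩ := h
      exact ih h

theorem lookup_wellKinded {Γ : Ctx} (hΓ : CtxWellKinded Γ) : ∀ {X : ℕ} {A : Ty} {K : Kind},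
    lookup Γ X = some (A, K) → WellKinded (Γ.map Prod.snd) A K := by
  induction Γ with
  | nil => intro X A K h; cases h
  | cons p Γ ih =>
    intro X A K h
    cases X with
    | zero => cases h; exact hΓ.2.shift _
    | succ X =>
      simp only [lookup, Option.map_eq_some_iff, Prod.mk.injEq] at h
      obtain ⟨⟨A', K'⟩, h, rfl, rfl⟩ := h
      exact (ih hΓ.1 h).shift _

theorem HasKind.wellKinded {Γ : Ctx} {A : Ty} {K : Kind} (h : HasKind Γ A K) :
    CtxWellKinded Γ ∧ WellKinded (Γ.map Prod.snd) A K := by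
  refine HasKind.rec (motive_1 := fun Γ _ => CtxWellKinded Γ)
    (motive_2 := fun Γ A K _ => CtxWellKinded Γ ∧ WellKinded (Γ.map Prod.snd) A K)
    ?_ ?_ ?_ ?_ ?_ ?_ ?_ ?_ h
  · trivial
  · exact fun _ ih => ih
  · exact fun _ hX ih => ⟨ih, .var (lookup_kind hX)⟩
  · exact fun _ ih => ⟨ih, .top⟩
  · exact fun _ ih => ⟨ih.1.1, .abs ih.2⟩
  · exact fun _ _ ih₁ ih₂ => ⟨ih₁.1, .app ih₁.2 ih₂.2⟩
  · exact fun _ _ ih₁ ih₂ => ⟨ih₁.1, .arrow ih₁.2 ih₂.2⟩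
  · exact fun _ ih => ⟨ih.1.1, .all ih.1.2 ih.2⟩

theorem Ok.ctxWellKinded : ∀ {Γ : Ctx}, Ok Γ → CtxWellKinded Γ
  | _, .nil => trivial
  | _, .cons h => h.wellKinded

end Curry

/-! ## Renaming and substitution of Church-style types -/

namespace Church

/-- Renaming of the variables of an entry. -/
def Entry.rename (ρ : ℕ → ℕ) : Entry → Entry
  | .ren Y => .ren (ρ Y)
  | .sub B => .sub (B.rename ρ)

namespace Ty

theorem rename_rename (A : Ty) : ∀ ρ τ : ℕ → ℕ, rename ρ (rename τ A) = rename (ρ ∘ τ) A := by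
  induction A <;> intro ρ τ <;> simp_all [rename, liftRen_comp]

theorem rename_shift (ρ : ℕ → ℕ) (A : Ty) : rename (liftRen ρ) A.shift = (rename ρ A).shift := by
  simp only [shift, rename_rename]; rfl

theorem liftSubst_comp_liftRen (γ : ℕ → Entry) (ρ : ℕ → ℕ) :
    liftSubst γ ∘ liftRen ρ = liftSubst (γ ∘ ρ) := by
  funext n; cases n <;> rfl

theorem subst_rename (A : Ty) :
    ∀ (γ : ℕ → Entry) (ρ : ℕ → ℕ), subst γ (rename ρ A) = subst (γ ∘ ρ) A := by
  induction A with
  | var X A ih => intro γ ρ; simp only [rename, subst, ih]; rfl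
  | _ => intro γ ρ; simp_all [rename, subst, liftSubst_comp_liftRen]

theorem rename_comp_liftSubst (ρ : ℕ → ℕ) (γ : ℕ → Entry) :
    Entry.rename (liftRen ρ) ∘ liftSubst γ = liftSubst (Entry.rename ρ ∘ γ) := by
  funext n
  cases n with
  | zero => rfl
  | succ n =>
    simp only [Function.comp, liftSubst]
    cases γ n with
    | ren Y => rfl
    | sub B => exact congrArg Entry.sub (rename_shift ρ B)

theorem rename_subst (A : Ty) :
    ∀ (ρ : ℕ → ℕ) (γ : ℕ → Entry), rename ρ (subst γ A) = subst (Entry.rename ρ ∘ γ) A := by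
  induction A with
  | var X A ih =>
    intro ρ γ
    simp only [subst, Function.comp]
    cases γ X with
    | ren Y => simp only [rename, Entry.rename, ih]
    | sub B => rfl
  | _ => intro ρ γ; simp_all [rename, subst, rename_comp_liftSubst]

theorem subst_shift (γ : ℕ → Entry) (A : Ty) :
    subst (liftSubst γ) A.shift = (subst γ A).shift := by
  simp only [shift, subst_rename, rename_subst]
  congr 1

theorem liftSubst_ren : liftSubst Entry.ren = Entry.ren := by
  funext n; cases n <;> rfl

theorem subst_ren (A : Ty) : subst Entry.ren A = A := by
  induction A <;> simp_all [subst, liftSubst_ren]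

theorem inst_shift (A B : Ty) : inst A.shift B = A := by
  simp only [inst, shift, subst_rename]
  exact subst_ren A

theorem rename_inst (ρ : ℕ → ℕ) (A B : Ty) :
    rename ρ (inst A B) = inst (rename (liftRen ρ) A) (rename ρ B) := by
  simp only [inst, rename_subst, subst_rename]
  congr 1
  funext n; cases n <;> rfl

theorem rename_topAt (K : Kind) : ∀ ρ : ℕ → ℕ, rename ρ (topAt K) = topAt K := by
  induction K <;> intro ρ <;> simp_all [topAt, rename]

end Ty

/-! ## Weakening of the Church-style system -/

open Ty

theorem HasKind.topAt {Γ : Ctx} (h : Ok Γ) (K : Kind) : HasKind Γ (topAt K) K := by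
  induction K generalizing Γ with
  | star => exact h
  | arr K K' ihK ihK' => exact .abs (ihK' (.topExt (ihK h)))

/-- `ρ` maps the declarations of `Γ` to declarations of `Δ`. -/
def IsRenaming (ρ : ℕ → ℕ) (Γ Δ : Ctx) : Prop :=
  ∀ X A K, lookup Γ X = some (A, K) → lookup Δ (ρ X) = some (A.rename ρ, K)

theorem IsRenaming.shift (Γ : Ctx) (p : Ty × Kind) : IsRenaming Nat.succ Γ (p :: Γ) := by
  intro X A K h
  simp [lookup, h, Ty.shift]

theorem IsRenaming.lift {ρ : ℕ → ℕ} {Γ Δ : Ctx} (h : IsRenaming ρ Γ Δ) (A : Ty) (K : Kind) :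
    IsRenaming (liftRen ρ) ((A, K) :: Γ) ((A.rename ρ, K) :: Δ) := by
  intro X B L hX
  cases X with
  | zero => cases hX; simp [lookup, liftRen, rename_shift]
  | succ X =>
    simp only [lookup, Option.map_eq_some_iff, Prod.mk.injEq] at hX
    obtain ⟨⟨B', L'⟩, hX, rfl, rfl⟩ := hX
    simp [lookup, liftRen, h _ _ _ hX, rename_shift]

/-- The kinding `Γ ⊢ A : K` is stable under renamings into well-formed contexts. -/
def KindRenames (Γ : Ctx) (A : Ty) (K : Kind) : Prop :=
  ∀ ⦃Δ : Ctx⦄ ⦃ρ : ℕ → ℕ⦄, Ok Δ → IsRenaming ρ Γ Δ → HasKind Δ (A.rename ρ) K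

/-- The subtyping `Γ ⊢ A ≤ B : K` is stable under renamings into well-formed contexts. -/
def SubRenames (Γ : Ctx) (A B : Ty) (K : Kind) : Prop :=
  ∀ ⦃Δ : Ctx⦄ ⦃ρ : ℕ → ℕ⦄, Ok Δ → IsRenaming ρ Γ Δ → Sub Δ (A.rename ρ) (B.rename ρ) K

/-- The kindings of all bounds of a context are stable under renamings. -/
def CtxRenames : Ctx → Prop
  | [] => True
  | (A, K) :: Γ => CtxRenames Γ ∧ KindRenames Γ A K

theorem IsRenaming.liftTop {ρ : ℕ → ℕ} {Γ Δ : Ctx} (h : IsRenaming ρ Γ Δ) (K : Kind) :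
    IsRenaming (liftRen ρ) ((topAt K, K) :: Γ) ((topAt K, K) :: Δ) := by
  simpa only [rename_topAt] using h.lift (topAt K) K

theorem Ok.topAt {Γ : Ctx} (h : Ok Γ) (K : Kind) : Ok ((topAt K, K) :: Γ) :=
  .topExt (.topAt h K)

mutual

theorem HasKind.renames {Γ : Ctx} {A : Ty} {K : Kind} :
    HasKind Γ A K → CtxRenames Γ ∧ KindRenames Γ A K
  | .topEmp => ⟨trivial, fun _ _ hΔ _ => hΔ⟩
  | .topExt h => ⟨h.renames, fun _ _ hΔ _ => hΔ⟩
  | .var h hs hX =>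
    ⟨h.renames.1, fun _ _ hΔ hρ =>
      .var (h.renames.2 hΔ hρ) (hs.renames.2 hΔ hρ) (hρ _ _ _ hX)⟩
  | .abs h => ⟨h.renames.1.1, fun _ _ hΔ hρ => .abs (h.renames.2 (hΔ.topAt _) (hρ.liftTop _))⟩
  | .app h₁ h₂ =>
    ⟨h₁.renames.1, fun _ _ hΔ hρ => .app (h₁.renames.2 hΔ hρ) (h₂.renames.2 hΔ hρ)⟩
  | .arrow h₁ h₂ =>
    ⟨h₁.renames.1, fun _ _ hΔ hρ => .arrow (h₁.renames.2 hΔ hρ) (h₂.renames.2 hΔ hρ)⟩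
  | .all h =>
    ⟨h.renames.1.1, fun _ _ hΔ hρ =>
      .all (h.renames.2 (.topExt (h.renames.1.2 hΔ hρ)) (hρ.lift _ _))⟩

theorem Sub.renames {Γ : Ctx} {A B : Ty} {K : Kind} :
    Sub Γ A B K → CtxRenames Γ ∧ SubRenames Γ A B K
  | .refl h => ⟨h.renames.1, fun _ _ hΔ hρ => .refl (h.renames.2 hΔ hρ)⟩
  | .trans h₁ h₂ =>
    ⟨h₁.renames.1, fun _ _ hΔ hρ => .trans (h₁.renames.2 hΔ hρ) (h₂.renames.2 hΔ hρ)⟩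
  | .top h =>
    ⟨h.renames.1, fun _ _ hΔ hρ => by
      rw [rename_topAt]; exact .top (h.renames.2 hΔ hρ)⟩
  | .var h h₁ h₂ hX =>
    ⟨h.renames.1, fun _ _ hΔ hρ =>
      .var (h.renames.2 hΔ hρ) (h₁.renames.2 hΔ hρ) (h₂.renames.2 hΔ hρ) (hρ _ _ _ hX)⟩
  | .promote hs h hX =>
    ⟨h.renames.1, fun _ _ hΔ hρ =>
      .promote (hs.renames.2 hΔ hρ) (h.renames.2 hΔ hρ) (hρ _ _ _ hX)⟩
  | .abs h => ⟨h.renames.1.1, fun _ _ hΔ hρ => .abs (h.renames.2 (hΔ.topAt _) (hρ.liftTop _))⟩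
  | .app h h₁ h₂ =>
    ⟨h.renames.1, fun _ _ hΔ hρ =>
      .app (h.renames.2 hΔ hρ) (h₁.renames.2 hΔ hρ) (h₂.renames.2 hΔ hρ)⟩
  | .arrow h₁ h₂ =>
    ⟨h₁.renames.1, fun _ _ hΔ hρ => .arrow (h₁.renames.2 hΔ hρ) (h₂.renames.2 hΔ hρ)⟩
  | .all h₁ h₂ h =>
    ⟨h₁.renames.1, fun _ _ hΔ hρ =>
      .all (h₁.renames.2 hΔ hρ) (h₂.renames.2 hΔ hρ)
        (h.renames.2 (.topExt (h.renames.1.2 hΔ hρ)) (hρ.lift _ _))⟩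
  | .betaL h₁ h₂ =>
    ⟨h₂.renames.1, fun _ _ hΔ hρ => by
      rw [rename_inst]
      exact .betaL (h₁.renames.2 (hΔ.topAt _) (hρ.liftTop _)) (h₂.renames.2 hΔ hρ)⟩
  | .betaR h₁ h₂ =>
    ⟨h₂.renames.1, fun _ _ hΔ hρ => by
      rw [rename_inst]
      exact .betaR (h₁.renames.2 (hΔ.topAt _) (hρ.liftTop _)) (h₂.renames.2 hΔ hρ)⟩

end

theorem HasKind.shift {Γ : Ctx} {A B : Ty} {K L : Kind} (h : HasKind Γ A K)
    (hΓ : Ok ((B, L) :: Γ)) : HasKind ((B, L) :: Γ) A.shift K :=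
  h.renames.2 hΓ (.shift _ _)

theorem Sub.shift {Γ : Ctx} {A A' B : Ty} {K L : Kind} (h : Sub Γ A A' K)
    (hΓ : Ok ((B, L) :: Γ)) : Sub ((B, L) :: Γ) A.shift A'.shift K :=
  h.renames.2 hΓ (.shift _ _)

/-- Equality `Γ ⊢ A = B : K`. -/
def TyEq (Γ : Ctx) (A B : Ty) (K : Kind) : Prop :=
  Sub Γ A B K ∧ Sub Γ B A K

namespace TyEq

variable {Γ : Ctx} {A B C D : Ty} {K K' : Kind}

theorem refl (h : HasKind Γ A K) : TyEq Γ A A K := ⟨.refl h, .refl h⟩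

theorem symm (h : TyEq Γ A B K) : TyEq Γ B A K := ⟨h.2, h.1⟩

theorem trans (h₁ : TyEq Γ A B K) (h₂ : TyEq Γ B C K) : TyEq Γ A C K :=
  ⟨h₁.1.trans h₂.1, h₂.2.trans h₁.2⟩

theorem shift (h : TyEq Γ A B K) (hΓ : Ok ((C, K') :: Γ)) :
    TyEq ((C, K') :: Γ) A.shift B.shift K :=
  ⟨h.1.shift hΓ, h.2.shift hΓ⟩

theorem abs (h : TyEq ((topAt K, K) :: Γ) A B K') :
    TyEq Γ (Ty.abs K A) (Ty.abs K B) (.arr K K') :=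
  ⟨.abs h.1, .abs h.2⟩

theorem app (h₁ : TyEq Γ A C (.arr K K')) (h₂ : TyEq Γ B D K) :
    TyEq Γ (Ty.app A B) (Ty.app C D) K' :=
  ⟨.app h₁.1 h₂.1 h₂.2, .app h₁.2 h₂.2 h₂.1⟩

theorem arrow (h₁ : TyEq Γ A C .star) (h₂ : TyEq Γ B D .star) :
    TyEq Γ (Ty.arrow A B) (Ty.arrow C D) .star :=
  ⟨.arrow h₁.2 h₂.1, .arrow h₁.1 h₂.2⟩

theorem beta (h₁ : HasKind ((topAt K, K) :: Γ) A K') (h₂ : HasKind Γ B K) :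
    TyEq Γ (Ty.app (Ty.abs K A) B) (Ty.inst A B) K' :=
  ⟨.betaL h₁ h₂, .betaR h₁ h₂⟩

end TyEq

theorem lookup_kind {Γ : Ctx} : ∀ {X : ℕ} {K : Kind},
    (Γ.map Prod.snd)[X]? = some K → ∃ A, lookup Γ X = some (A, K) := by
  induction Γ with
  | nil => intro X K h; simp at h
  | cons p Γ ih =>
    intro X K h
    cases X with
    | zero => cases h; exact ⟨_, rfl⟩
    | succ X =>
      obtain ⟨A, hA⟩ := ih (X := X) (K := K) (by simpa using h)
      exact ⟨A.shift, by simp [lookup, hA]⟩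

end Church
/-! ## Decoration by an assignment of bounds to variables -/

/-- Extension of an assignment of bounds by a bound for a new variable. -/
def extend (b : ℕ → Church.Ty) (A : Church.Ty) : ℕ → Church.Ty
  | 0 => A.shift
  | n + 1 => (b n).shift

/-- Decoration of a type by a total assignment of bounds to variables. -/
def dec : (ℕ → Church.Ty) → Curry.Ty → Church.Ty
  | b, .var X => .var X (b X)
  | _, .top => .top
  | b, .arrow A B => .arrow (dec b A) (dec b B)
  | b, .all A K B => .all (dec b A) K (dec (extend b (dec b A)) B)
  | b, .abs K A => .abs K (dec (extend b (Church.Ty.topAt K)) A)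
  | b, .app A B => .app (dec b A) (dec b B)

theorem extend_liftRen {b b' : ℕ → Church.Ty} {ρ : ℕ → ℕ} (h : ∀ X, b' (ρ X) = (b X).rename ρ)
    (A : Church.Ty) (X : ℕ) :
    extend b' (A.rename ρ) (liftRen ρ X) = (extend b A X).rename (liftRen ρ) := by
  cases X with
  | zero => exact (Church.Ty.rename_shift ρ A).symm
  | succ X => simp only [extend, liftRen, h, Church.Ty.rename_shift]

theorem dec_rename (T : Curry.Ty) : ∀ {b b' : ℕ → Church.Ty} {ρ : ℕ → ℕ},
    (∀ X, b' (ρ X) = (b X).rename ρ) → dec b' (T.rename ρ) = (dec b T).rename ρ := by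
  induction T with
  | var X => intro b b' ρ h; simp only [Curry.Ty.rename, dec, Church.Ty.rename, h]
  | top => intros; rfl
  | arrow A B ihA ihB =>
    intro b b' ρ h
    simp only [Curry.Ty.rename, dec, Church.Ty.rename, ihA h, ihB h]
  | all A K B ihA ihB =>
    intro b b' ρ h
    simp only [Curry.Ty.rename, dec, Church.Ty.rename, ihA h, ihB (extend_liftRen h _)]
  | abs K A ih =>
    intro b b' ρ h
    have := ih (extend_liftRen h (Church.Ty.topAt K))
    rw [Church.Ty.rename_topAt] at this
    simp only [Curry.Ty.rename, dec, Church.Ty.rename, this]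
  | app A B ihA ihB =>
    intro b b' ρ h
    simp only [Curry.Ty.rename, dec, Church.Ty.rename, ihA h, ihB h]

theorem dec_shift (b : ℕ → Church.Ty) (A : Church.Ty) (T : Curry.Ty) :
    dec (extend b A) T.shift = (dec b T).shift :=
  dec_rename T fun _ => rfl

theorem dec_topAt (K : Kind) :
    ∀ b : ℕ → Church.Ty, dec b (Curry.Ty.topAt K) = Church.Ty.topAt K := by
  induction K <;> intro b <;> simp_all [Curry.Ty.topAt, Church.Ty.topAt, dec]

/-- The value of a Curry-style substitution at a variable `X` of bound `A` corresponds, under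
decoration by `b`, to the entry of a Church-style substitution `γ`. -/
def EntryDecorates (b : ℕ → Church.Ty) (γ : ℕ → Church.Entry) (T : Curry.Ty) (A : Church.Ty) :
    Church.Entry → Prop
  | .ren Y => T = .var Y ∧ b Y = A.subst γ
  | .sub B => dec b T = B

theorem EntryDecorates.lift {b b' : ℕ → Church.Ty} {γ : ℕ → Church.Entry} {σ : ℕ → Curry.Ty}
    (h : ∀ X, EntryDecorates b' γ (σ X) (b X) (γ X)) (A : Church.Ty) (X : ℕ) :
    EntryDecorates (extend b' (A.subst γ)) (Church.Ty.liftSubst γ) (Curry.Ty.liftSubst σ X)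
      (extend b A X) (Church.Ty.liftSubst γ X) := by
  cases X with
  | zero => exact ⟨rfl, (Church.Ty.subst_shift γ A).symm⟩
  | succ X =>
    have hX := h X
    simp only [Church.Ty.liftSubst, Curry.Ty.liftSubst, extend]
    cases hγ : γ X with
    | ren Y =>
      rw [hγ] at hX
      obtain ⟨h₁, h₂⟩ := hX
      refine ⟨by rw [h₁]; rfl, ?_⟩
      rw [Church.Ty.subst_shift, ← h₂]
      rfl
    | sub B =>
      rw [hγ] at hX
      change dec _ _ = _
      rw [dec_shift, show dec b' (σ X) = B from hX]

theorem subst_topAt (K : Kind) :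
    ∀ γ : ℕ → Church.Entry, (Church.Ty.topAt K).subst γ = Church.Ty.topAt K := by
  induction K <;> intro γ <;> simp_all [Church.Ty.topAt, Church.Ty.subst]

theorem dec_subst (T : Curry.Ty) :
    ∀ {b b' : ℕ → Church.Ty} {γ : ℕ → Church.Entry} {σ : ℕ → Curry.Ty},
      (∀ X, EntryDecorates b' γ (σ X) (b X) (γ X)) → dec b' (T.subst σ) = (dec b T).subst γ := by
  induction T with
  | var X =>
    intro b b' γ σ h
    have hX := h X
    simp only [Curry.Ty.subst, dec, Church.Ty.subst]
    cases hγ : γ X with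
    | ren Y =>
      rw [hγ] at hX
      simp only [hX.1, dec, hX.2]
    | sub B =>
      rw [hγ] at hX
      exact hX
  | top => intros; rfl
  | arrow A B ihA ihB =>
    intro b b' γ σ h
    simp only [Curry.Ty.subst, dec, Church.Ty.subst, ihA h, ihB h]
  | all A K B ihA ihB =>
    intro b b' γ σ h
    simp only [Curry.Ty.subst, dec, Church.Ty.subst, ihA h, ihB (EntryDecorates.lift h _)]
  | abs K A ih =>
    intro b b' γ σ h
    have := ih (EntryDecorates.lift h (Church.Ty.topAt K))
    rw [subst_topAt] at this
    simp only [Curry.Ty.subst, dec, Church.Ty.subst, this]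
  | app A B ihA ihB =>
    intro b b' γ σ h
    simp only [Curry.Ty.subst, dec, Church.Ty.subst, ihA h, ihB h]

theorem dec_inst (b : ℕ → Church.Ty) (C : Church.Ty) (A B : Curry.Ty) :
    dec b (A.inst B) = (dec (extend b C) A).inst (dec b B) := by
  refine dec_subst A fun X => ?_
  cases X with
  | zero => exact rfl
  | succ X => exact ⟨rfl, (Church.Ty.inst_shift (b X) _).symm⟩

/-! ## Well-kinded decorations -/

/-- The bounds assigned by `b` are well-kinded over `Δ` and lie above the bounds declared
in `Δ`. -/
structure Admissible (Δ : Church.Ctx) (b : ℕ → Church.Ty) : Prop where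
  ok : Church.Ok Δ
  hasKind : ∀ {X A K}, Church.lookup Δ X = some (A, K) → Church.HasKind Δ (b X) K
  sub : ∀ {X A K}, Church.lookup Δ X = some (A, K) → Church.Sub Δ A (b X) K

theorem Admissible.extend {Δ : Church.Ctx} {b : ℕ → Church.Ty} (h : Admissible Δ b)
    {A B : Church.Ty} {K : Kind} (hA : Church.HasKind Δ A K) (hB : Church.HasKind Δ B K)
    (hAB : Church.Sub Δ A B K) : Admissible ((A, K) :: Δ) (extend b B) := by
  have hok : Church.Ok ((A, K) :: Δ) := .topExt hA
  refine ⟨hok, fun {X C L} hX => ?_, fun {X C L} hX => ?_⟩ <;> cases X with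
  | zero => cases hX; first | exact hB.shift hok | exact hAB.shift hok
  | succ X =>
    simp only [Church.lookup, Option.map_eq_some_iff, Prod.mk.injEq] at hX
    obtain ⟨⟨C', L'⟩, hX, rfl, rfl⟩ := hX
    first | exact (h.hasKind hX).shift hok | exact (h.sub hX).shift hok

theorem Admissible.extendTop {Δ : Church.Ctx} {b : ℕ → Church.Ty} (h : Admissible Δ b) (K : Kind) :
    Admissible ((Church.Ty.topAt K, K) :: Δ) (FOmegaSub.extend b (Church.Ty.topAt K)) :=
  have hK := Church.HasKind.topAt h.ok K
  h.extend hK hK (.refl hK)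

theorem dec_hasKind {Θ : List Kind} {T : Curry.Ty} {K : Kind} (hT : Curry.WellKinded Θ T K) :
    ∀ {Δ : Church.Ctx} {b : ℕ → Church.Ty}, Δ.map Prod.snd = Θ → Admissible Δ b →
      Church.HasKind Δ (dec b T) K := by
  induction hT with
  | var hX =>
    rintro Δ b rfl hb
    obtain ⟨A, hA⟩ := Church.lookup_kind hX
    exact .var (hb.hasKind hA) (hb.sub hA) hA
  | top => exact fun _ hb => hb.ok
  | abs _ ih =>
    rintro Δ b rfl hb
    exact .abs (ih rfl (hb.extendTop _))
  | app _ _ ih₁ ih₂ => exact fun hΔ hb => .app (ih₁ hΔ hb) (ih₂ hΔ hb)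
  | arrow _ _ ih₁ ih₂ => exact fun hΔ hb => .arrow (ih₁ hΔ hb) (ih₂ hΔ hb)
  | all _ _ ih₁ ih₂ =>
    rintro Δ b rfl hb
    have hA := ih₁ rfl hb
    exact .all (ih₂ rfl (hb.extend hA hA (.refl hA)))

/-- Two assignments agree up to equality over `Δ`. -/
def AssignEq (Δ : Church.Ctx) (b b' : ℕ → Church.Ty) : Prop :=
  ∀ ⦃X A K⦄, Church.lookup Δ X = some (A, K) → Church.TyEq Δ (b X) (b' X) K

theorem AssignEq.symm {Δ : Church.Ctx} {b b' : ℕ → Church.Ty} (h : AssignEq Δ b b') :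
    AssignEq Δ b' b :=
  fun _ _ _ hX => (h hX).symm

theorem Admissible.assignEq_refl {Δ : Church.Ctx} {b : ℕ → Church.Ty} (h : Admissible Δ b) :
    AssignEq Δ b b :=
  fun _ _ _ hX => .refl (h.hasKind hX)

theorem AssignEq.extend {Δ : Church.Ctx} {b b' : ℕ → Church.Ty} (h : AssignEq Δ b b')
    {A B C : Church.Ty} {K : Kind} (hBC : Church.TyEq Δ B C K) (hok : Church.Ok ((A, K) :: Δ)) :
    AssignEq ((A, K) :: Δ) (extend b B) (extend b' C) := by
  intro X D L hX
  cases X with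
  | zero => cases hX; exact hBC.shift hok
  | succ X =>
    simp only [Church.lookup, Option.map_eq_some_iff, Prod.mk.injEq] at hX
    obtain ⟨⟨D', L'⟩, hX, rfl, rfl⟩ := hX
    exact (h hX).shift hok

theorem dec_congr {Θ : List Kind} {T : Curry.Ty} {K : Kind} (hT : Curry.WellKinded Θ T K) :
    ∀ {Δ : Church.Ctx} {b b' : ℕ → Church.Ty}, Δ.map Prod.snd = Θ → Admissible Δ b →
      Admissible Δ b' → AssignEq Δ b b' → Church.TyEq Δ (dec b T) (dec b' T) K := by
  induction hT with
  | var hX =>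
    rintro Δ b b' rfl hb hb' h
    obtain ⟨A, hA⟩ := Church.lookup_kind hX
    exact ⟨.var (hb.sub hA) (h hA).1 (h hA).2 hA, .var (hb'.sub hA) (h hA).2 (h hA).1 hA⟩
  | top => exact fun _ hb _ _ => .refl hb.ok
  | abs _ ih =>
    rintro Δ b b' rfl hb hb' h
    have hK := Church.HasKind.topAt hb.ok
    exact .abs (ih rfl (hb.extendTop _) (hb'.extendTop _)
      (h.extend (.refl (hK _)) (.topExt (hK _))))
  | app _ _ ih₁ ih₂ => exact fun hΔ hb hb' h => .app (ih₁ hΔ hb hb' h) (ih₂ hΔ hb hb' h)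
  | arrow _ _ ih₁ ih₂ => exact fun hΔ hb hb' h => .arrow (ih₁ hΔ hb hb' h) (ih₂ hΔ hb hb' h)
  | all hA _ ih₁ ih₂ =>
    rintro Δ b b' rfl hb hb' h
    have key {b b' : ℕ → Church.Ty} (hb : Admissible Δ b) (hb' : Admissible Δ b')
        (h : AssignEq Δ b b') := by
      have hAb := dec_hasKind hA rfl hb
      have hAA := ih₁ rfl hb hb' h
      exact Church.Sub.all hAA.1 hAA.2 (ih₂ rfl (hb.extend hAb hAb (.refl hAb))
        (hb'.extend hAb (dec_hasKind hA rfl hb') hAA.1) (h.extend hAA (.topExt hAb))).1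
    exact ⟨key hb hb' h, key hb' hb h.symm⟩

theorem dec_tyEq_of_par {T T' : Curry.Ty} (h : Curry.Ty.Par T T') :
    ∀ {Δ : Church.Ctx} {b : ℕ → Church.Ty} {K : Kind}, Admissible Δ b →
      Curry.WellKinded (Δ.map Prod.snd) T K → Church.TyEq Δ (dec b T) (dec b T') K := by
  induction h with
  | var X => exact fun hb hT => .refl (dec_hasKind hT rfl hb)
  | top => exact fun hb hT => .refl (dec_hasKind hT rfl hb)
  | arrow _ _ ih₁ ih₂ =>
    intro Δ b K hb hT
    cases hT with
    | arrow h₁ h₂ => exact .arrow (ih₁ hb h₁) (ih₂ hb h₂)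
  | @all A A' B B' K hA hB ih₁ ih₂ =>
    intro Δ b _ hb hT
    cases hT with
    | all h₁ h₂ =>
      have hAA := ih₁ hb h₁
      have hkA := dec_hasKind h₁ rfl hb
      have hkA' := dec_hasKind (h₁.par hA) rfl hb
      have ad := hb.extend hkA hkA (.refl hkA)
      have ad' := hb.extend hkA' hkA' (.refl hkA')
      constructor
      · exact .all hAA.1 hAA.2 ((ih₂ ad h₂).trans (dec_congr (h₂.par hB) rfl ad
          (hb.extend hkA hkA' hAA.1) (hb.assignEq_refl.extend hAA ad.ok))).1
      · exact .all hAA.2 hAA.1 ((dec_congr h₂ rfl (hb.extend hkA' hkA hAA.2) ad'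
          (hb.assignEq_refl.extend hAA ad'.ok)).trans (ih₂ ad' h₂)).2
  | abs K _ ih =>
    intro Δ b _ hb hT
    cases hT with
    | abs h => exact .abs (ih (hb.extendTop K) h)
  | app _ _ ih₁ ih₂ =>
    intro Δ b K hb hT
    cases hT with
    | app h₁ h₂ => exact .app (ih₁ hb h₁) (ih₂ hb h₂)
  | @beta A A' B B' K hA hB ih₁ ih₂ =>
    intro Δ b _ hb hT
    cases hT with
    | app h₁ h₂ =>
      cases h₁ with
      | abs h₁ =>
        rw [dec_inst b (Church.Ty.topAt K)]
        have hb' := hb.extendTop K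
        exact (Church.TyEq.app (.abs (ih₁ hb' h₁)) (ih₂ hb h₂)).trans
          (.beta (dec_hasKind (h₁.par hA) rfl hb') (dec_hasKind (h₂.par hB) rfl hb))

theorem dec_tyEq_of_betaEq {Δ : Church.Ctx} {b : ℕ → Church.Ty} {A B : Curry.Ty} {K : Kind}
    (hb : Admissible Δ b) (hA : Curry.WellKinded (Δ.map Prod.snd) A K)
    (hB : Curry.WellKinded (Δ.map Prod.snd) B K) (h : Curry.Ty.BetaEq A B) :
    Church.TyEq Δ (dec b A) (dec b B) K := by
  have key {A C : Curry.Ty} (hA : Curry.WellKinded (Δ.map Prod.snd) A K)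
      (h : Relation.ReflTransGen Curry.Ty.Par A C) :
      Curry.WellKinded (Δ.map Prod.snd) C K ∧ Church.TyEq Δ (dec b A) (dec b C) K := by
    induction h with
    | refl => exact ⟨hA, .refl (dec_hasKind hA rfl hb)⟩
    | tail _ h ih => exact ⟨ih.1.par h, ih.2.trans (dec_tyEq_of_par h hb ih.1)⟩
  obtain ⟨C, hAC, hBC⟩ := h.join_par
  exact (key hA hAC).2.trans (key hB hBC).2.symm

/-! ## Decoration of contexts -/

/-- The assignment of bounds given by a context. -/
def bounds : Church.Ctx → ℕ → Church.Ty
  | [] => fun _ => .top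
  | (A, _) :: Δ => extend (bounds Δ) A

theorem lookup_eq_bounds {Δ : Church.Ctx} : ∀ {X : ℕ} {A : Church.Ty} {K : Kind},
    Church.lookup Δ X = some (A, K) → A = bounds Δ X := by
  induction Δ with
  | nil => intro X A K h; cases h
  | cons p Δ ih =>
    intro X A K h
    cases X with
    | zero => cases h; rfl
    | succ X =>
      simp only [Church.lookup, Option.map_eq_some_iff, Prod.mk.injEq] at h
      obtain ⟨⟨A', K'⟩, h, rfl, rfl⟩ := h
      exact congrArg Church.Ty.shift (ih h)

theorem decorate_eq_dec {Θ : List Kind} {T : Curry.Ty} {K : Kind} (hT : Curry.WellKinded Θ T K) :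
    ∀ {Δ : Church.Ctx}, Δ.map Prod.snd = Θ → decorate Δ T = some (dec (bounds Δ) T) := by
  induction hT with
  | var hX =>
    rintro Δ rfl
    obtain ⟨A, hA⟩ := Church.lookup_kind hX
    simp [decorate, dec, hA, lookup_eq_bounds hA]
  | top => exact fun _ => rfl
  | abs _ ih =>
    rintro Δ rfl
    simp only [decorate, dec, ih (Δ := (_, _) :: Δ) rfl, Option.bind_some, bounds]
  | app _ _ ih₁ ih₂ => intro Δ h; simp only [decorate, dec, ih₁ h, ih₂ h, Option.bind_some]
  | arrow _ _ ih₁ ih₂ => intro Δ h; simp only [decorate, dec, ih₁ h, ih₂ h, Option.bind_some]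
  | all _ _ ih₁ ih₂ =>
    rintro Δ rfl
    simp only [decorate, dec, ih₁ rfl, ih₂ (Δ := (_, _) :: Δ) rfl, Option.bind_some, bounds]

/-- Decoration of contexts by the assignments of bounds they give. -/
def decCtx : Curry.Ctx → Church.Ctx
  | [] => []
  | (A, K) :: Γ => (dec (bounds (decCtx Γ)) A, K) :: decCtx Γ

theorem map_snd_decCtx (Γ : Curry.Ctx) : (decCtx Γ).map Prod.snd = Γ.map Prod.snd := by
  induction Γ <;> simp_all [decCtx]

theorem decorateCtx_eq_decCtx {Γ : Curry.Ctx} (hΓ : Curry.CtxWellKinded Γ) :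
    decorateCtx Γ = some (decCtx Γ) := by
  induction Γ with
  | nil => rfl
  | cons p Γ ih =>
    simp only [decorateCtx, decCtx, ih hΓ.1, decorate_eq_dec hΓ.2 (map_snd_decCtx Γ),
      Option.bind_some]

theorem admissible_decCtx {Γ : Curry.Ctx} (hΓ : Curry.CtxWellKinded Γ) :
    Admissible (decCtx Γ) (bounds (decCtx Γ)) := by
  induction Γ with
  | nil => exact ⟨.topEmp, fun h => by simp [decCtx, Church.lookup] at h,
      fun h => by simp [decCtx, Church.lookup] at h⟩
  | cons p Γ ih =>
    have hA := dec_hasKind hΓ.2 (map_snd_decCtx Γ) (ih hΓ.1)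
    exact (ih hΓ.1).extend hA hA (.refl hA)

theorem lookup_decCtx {Γ : Curry.Ctx} : ∀ {X : ℕ} {A : Curry.Ty} {K : Kind},
    Curry.lookup Γ X = some (A, K) →
      Church.lookup (decCtx Γ) X = some (dec (bounds (decCtx Γ)) A, K) := by
  induction Γ with
  | nil => intro X A K h; cases h
  | cons p Γ ih =>
    intro X A K h
    cases X with
    | zero => cases h; simp only [decCtx, Church.lookup, bounds, dec_shift]
    | succ X =>
      simp only [Curry.lookup, Option.map_eq_some_iff, Prod.mk.injEq] at h
      obtain ⟨⟨A', K'⟩, h, rfl, rfl⟩ := h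
      simp only [decCtx, Church.lookup, bounds, dec_shift, ih h, Option.map_some]

theorem hasKind_decCtx {Γ : Curry.Ctx} {A : Curry.Ty} {K : Kind}
    (hΓ : Curry.CtxWellKinded Γ) (hA : Curry.WellKinded (Γ.map Prod.snd) A K) :
    Church.HasKind (decCtx Γ) (dec (bounds (decCtx Γ)) A) K :=
  dec_hasKind hA (map_snd_decCtx Γ) (admissible_decCtx hΓ)

theorem Curry.Sub.dec_decCtx {Γ : Curry.Ctx} {A B : Curry.Ty} (h : Curry.Sub Γ A B) :
    ∃ K, Curry.CtxWellKinded Γ ∧ Curry.WellKinded (Γ.map Prod.snd) A K ∧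
      Curry.WellKinded (Γ.map Prod.snd) B K ∧
      Church.Sub (decCtx Γ) (dec (bounds (decCtx Γ)) A) (dec (bounds (decCtx Γ)) B) K := by
  induction h with
  | @conv Γ A B K hA hB h =>
    obtain ⟨hΓ, hA⟩ := hA.wellKinded
    have hB := hB.wellKinded.2
    refine ⟨K, hΓ, hA, hB, (dec_tyEq_of_betaEq (admissible_decCtx hΓ) ?_ ?_ h).1⟩ <;>
      rwa [map_snd_decCtx]
  | trans _ _ ih₁ ih₂ =>
    obtain ⟨K, hΓ, hA, hB, h₁⟩ := ih₁
    obtain ⟨K', -, hB', hC, h₂⟩ := ih₂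
    cases hB.unique hB'
    exact ⟨K, hΓ, hA, hC, h₁.trans h₂⟩
  | @top Γ A K h =>
    obtain ⟨hΓ, hA⟩ := h.wellKinded
    refine ⟨K, hΓ, hA, .topAt _ K, ?_⟩
    rw [dec_topAt]
    exact .top (hasKind_decCtx hΓ hA)
  | @var Γ X A K h hX =>
    have hΓ := h.ctxWellKinded
    have hA := Curry.lookup_wellKinded hΓ hX
    have hkA := hasKind_decCtx hΓ hA
    have hX' := lookup_decCtx hX
    refine ⟨K, hΓ, .var (Curry.lookup_kind hX), hA, ?_⟩
    simp only [dec, ← lookup_eq_bounds hX']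
    exact .promote (.refl hkA) hkA hX'
  | @abs Γ A B K h ih =>
    obtain ⟨K', hΓ, hA, hB, h⟩ := ih
    refine ⟨_, hΓ.1, .abs hA, .abs hB, .abs ?_⟩
    simpa only [decCtx, bounds, dec_topAt] using h
  | app _ hk ih =>
    obtain ⟨L, hΓ, hA, hB, h⟩ := ih
    cases hk.wellKinded.2 with
    | app hA' hC =>
      cases hA.unique hA'
      have hC' := Church.Sub.refl (hasKind_decCtx hΓ hC)
      exact ⟨_, hΓ, .app hA hC, .app hB hC, .app h hC' hC'⟩
  | arrow _ _ hk ih₁ ih₂ =>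
    obtain ⟨L₁, hΓ, hB₁, hA₁, h₁⟩ := ih₁
    obtain ⟨L₂, -, hA₂, hB₂, h₂⟩ := ih₂
    cases hk.wellKinded.2 with
    | arrow hA₁' hA₂' =>
      cases hA₁.unique hA₁'
      cases hA₂.unique hA₂'
      exact ⟨_, hΓ, .arrow hA₁ hA₂, .arrow hB₁ hB₂, .arrow h₁ h₂⟩
  | all _ hk ih =>
    obtain ⟨L, hΓ, hB, hD, h⟩ := ih
    cases hk.wellKinded.2 with
    | all hA hB' =>
      cases hB.unique hB'
      have hA' := Church.Sub.refl (hasKind_decCtx hΓ.1 hA)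
      exact ⟨_, hΓ.1, .all hA hB, .all hA hD, .all hA' hA' h⟩

end FOmegaSub

theorem mainTheorem9 :
    (∀ (Γ : Curry.Ctx) (A : Curry.Ty) (K : Kind), Curry.HasKind Γ A K →
      ∃ (Γd : Church.Ctx) (Ad : Church.Ty),
        decorateCtx Γ = some Γd ∧ decorate Γd A = some Ad ∧
        Church.HasKind Γd Ad K) ∧
    (∀ (Γ : Curry.Ctx) (A B : Curry.Ty) (K : Kind),
      Curry.Sub Γ A B → Curry.HasKind Γ A K → Curry.HasKind Γ B K →
      ∃ (Γd : Church.Ctx) (Ad Bd : Church.Ty),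
        decorateCtx Γ = some Γd ∧ decorate Γd A = some Ad ∧ decorate Γd B = some Bd ∧
        Church.Ok Γd ∧ Church.HasKind Γd Ad K ∧ Church.HasKind Γd Bd K ∧
        Church.Sub Γd Ad Bd K) := by
  constructor
  · intro Γ A K h
    obtain ⟨hΓ, hA⟩ := h.wellKinded
    exact ⟨_, _, decorateCtx_eq_decCtx hΓ, decorate_eq_dec hA (map_snd_decCtx Γ),
      hasKind_decCtx hΓ hA⟩
  · intro Γ A B K h hA hB
    obtain ⟨K', hΓ, hA', hB', h⟩ := h.dec_decCtx
    cases hA'.unique hA.wellKinded.2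
    exact ⟨_, _, _, decorateCtx_eq_decCtx hΓ, decorate_eq_dec hA' (map_snd_decCtx Γ),
      decorate_eq_dec hB' (map_snd_decCtx Γ), (admissible_decCtx hΓ).ok,
      hasKind_decCtx hΓ hA', hasKind_decCtx hΓ hB', h⟩
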